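/- Let $\alpha_1,\alpha_2>0$ be known. For $\kappa_1,\kappa_2>0$ let $Y_1,Y_2$ be independent, $Y_i$ gamma distributed with shape $\alpha_i$ and rate $\alpha_i/\kappa_i$ (so $\mathsf E Y_i=\kappa_i$). Let $\mathscr T:\mathbb R^2\to\mathbb R$ be measurable. Call $\mathscr T(Y_1,Y_2)$ unbiased for $\tau=1/(\kappa_1-\kappa_2)$ at $(\kappa_1,\kappa_2)$, $\kappa_1\ne\kappa_2$, if it is integrable under $(\kappa_1,\kappa_2)$ with expected value $1/(\kappa_1-\kappa_2)$. Throughout, $\mathsf{Var}=\infty$ means that the second moment is infinite, also where the expected value does not exist. (1) If $\mathscr T$ is unbiased for $\tau$ at all $\kappa_1,\kappa_2>0$ with $\kappa_1\neq\kappa_2$, then $\mathsf{Var}\,\mathscr T(Y_1,Y_2)=\infty$ at all $\kappa_1,\kappa_2>0$ with $1/2<\kappa_2/\kappa_1<2$. (2) The following one-sided versions, with one of the two parameters known, hold as well. If $\kappa_1>0$ is fixed and $\mathscr T$ (which may depend on this $\kappa_1$) is unbiased for $\tau$ at $(\kappa_1,\kappa_2)$ for all $0<\kappa_2<\kappa_1$,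 then $\mathsf{Var}\,\mathscr T(Y_1,Y_2)=\infty$ at $(\kappa_1,\kappa_2)$ whenever $1/2<\kappa_2/\kappa_1\le1$. If $\kappa_2>0$ is fixed and $\mathscr T$ is unbiased for $\tau$ at $(\kappa_1,\kappa_2)$ for all $0<\kappa_1<\kappa_2$, then $\mathsf{Var}\,\mathscr T(Y_1,Y_2)=\infty$ at $(\kappa_1,\kappa_2)$ whenever $1\le\kappa_2/\kappa_1<2$. Conversion gain. Let $n_1,n_2\ge2$. For parameters $g>0$ (conversion gain), $\mu_e\ge0$ (mean number of photon induced electrons), $\mu_d>0$ and $\sigma_d^2>0$ put $\mu_{p+d}=\mu_d+\mu_e/g$, $\sigma_{p+d}^2=\sigma_d^2+\mu_e/g^2$ and $\zeta=\sigma_d^2/\sigma_{p+d}^2\in(0,1]$, so that $g=(\mu_{p+d}-\mu_d)/(\sigma_{p+d}^2-\sigma_d^2)$ when $\mu_e>0$. Let $X_1,\dots,X_{n_1}\sim\mathcal N(\mu_{p+d},\sigma_{p+d}^2)$ and $Y_1,\dots,Y_{n_2}\sim\mathcal N(\mu_d,\sigma_d^2)$ all be independent, and let $\mathscr G:\mathbb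 R^{n_1}\times\mathbb R^{n_2}\to\mathbb R$ be measurable. (3) If $\mathscr G(X,Y)$ is integrable with expected value $g$ for all parameters with $\mu_e>0$, then $\mathsf{Var}\,\mathscr G(X,Y)=\infty$ for all parameters with $\zeta\in(1/2,1]$. (4) The same holds when the illuminated variance is known: if $v>0$ is fixed and $\mathscr G(X,Y)$ is integrable with expected value $g$ for all parameters with $\mu_e>0$ and $\sigma_{p+d}^2=v$, then $\mathsf{Var}\,\mathscr G(X,Y)=\infty$ for all parameters with $\sigma_{p+d}^2=v$ and $\zeta\in(1/2,1]$. -/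

import Mathlib

open MeasureTheory ProbabilityTheory

/-- The joint law of two independent gamma variables `Y₁`, `Y₂`, where `Yᵢ` has shape `αᵢ` and
rate `αᵢ / κᵢ` (so that `Yᵢ` has mean `κᵢ`). -/
noncomputable def gammaPairLaw (α₁ α₂ κ₁ κ₂ : ℝ) : Measure (ℝ × ℝ) :=
  (gammaMeasure α₁ (α₁ / κ₁)).prod (gammaMeasure α₂ (α₂ / κ₂))

/-- `T(Y₁, Y₂)` has a (finite) expected value, equal to `1 / (κ₁ - κ₂)`, when the parameters are
`κ₁`, `κ₂`. -/
def UnbiasedForTauAt (α₁ α₂ : ℝ) (T : ℝ × ℝ → ℝ) (κ₁ κ₂ : ℝ) : Prop :=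
  Integrable T (gammaPairLaw α₁ α₂ κ₁ κ₂) ∧
    ∫ y, T y ∂(gammaPairLaw α₁ α₂ κ₁ κ₂) = 1 / (κ₁ - κ₂)

/-- Parameters of the normal model of the noise of a pixel with linear transfer function: the
conversion gain `g`, the mean number `electrons` of photon induced electrons (zero exactly at zero
illumination), and the mean and the variance of the dark noise. -/
structure PixelParams where
  g : ℝ
  electrons : ℝ
  darkMean : ℝ
  darkVar : ℝ
  g_pos : 0 < g
  electrons_nonneg : 0 ≤ electrons
  darkMean_pos : 0 < darkMean
  darkVar_pos : 0 < darkVar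

namespace PixelParams

/-- The mean of the output of the illuminated pixel. -/
noncomputable def lightMean (θ : PixelParams) : ℝ := θ.darkMean + θ.electrons / θ.g

/-- The variance of the output of the illuminated pixel. -/
noncomputable def lightVar (θ : PixelParams) : ℝ := θ.darkVar + θ.electrons / θ.g ^ 2

/-- The ratio `ζ` of the dark and the illuminated variance. -/
noncomputable def zeta (θ : PixelParams) : ℝ := θ.darkVar / θ.lightVar

/-- At nonzero illumination the gain is the ratio of the photon induced mean and variance. -/
theorem g_eq (θ : PixelParams) (h : 0 < θ.electrons) :
    θ.g = (θ.lightMean - θ.darkMean) / (θ.lightVar - θ.darkVar) := by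
  have hg := θ.g_pos
  unfold lightMean lightVar
  rw [add_sub_cancel_left, add_sub_cancel_left]
  field_simp

/-- The joint law of `n₁` observations of the illuminated pixel and `n₂` observations of the dark
pixel, all of them independent and normal. -/
noncomputable def dataLaw (θ : PixelParams) (n₁ n₂ : ℕ) : Measure ((Fin n₁ → ℝ) × (Fin n₂ → ℝ)) :=
  (Measure.pi fun _ => gaussianReal θ.lightMean θ.lightVar.toNNReal).prod
    (Measure.pi fun _ => gaussianReal θ.darkMean θ.darkVar.toNNReal)

/-- `G(X, Y)` has a (finite) expected value, equal to the gain `g`, under the parameters `θ`. -/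
def UnbiasedForGainAt (θ : PixelParams) {n₁ n₂ : ℕ}
    (G : (Fin n₁ → ℝ) × (Fin n₂ → ℝ) → ℝ) : Prop :=
  Integrable G (θ.dataLaw n₁ n₂) ∧ ∫ z, G z ∂(θ.dataLaw n₁ n₂) = θ.g

end PixelParams

/-! The target `1 / (κ₁ - κ₂)` blows up as the parameters approach the diagonal, while the laws
there converge to a harmless limit law `ν₀`. Suppose `T` is square integrable under the law `μ` of
interest. If `dν₀/dμ` is in `L²(μ)`, then `T` is integrable under `ν₀` by Cauchy–Schwarz. The laws
close to the diagonal are at most `K • ν₀` with one constant `K`, so their means of `T` stay bounded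
by `K ∫ |T| dν₀`, contradicting unbiasedness (`evariance_eq_top_of_unbounded_mean`). The ratio 2 is
the threshold for `dν₀/dμ` to be square integrable, for gamma scales and normal variances alike. For
the gain, `ν₀` has equal variances but different means. -/

open scoped ENNReal NNReal

/-! ### Square integrable densities and the abstract argument -/

section Density

variable {α β : Type*} [MeasurableSpace α] [MeasurableSpace β]

/-- `μ` has a square integrable density with respect to `ν`. -/
def HasSqIntegrableDensity (μ ν : Measure α) : Prop :=
  ∃ f : α → ℝ≥0∞, Measurable f ∧ μ = ν.withDensity f ∧ ∫⁻ x, f x ^ 2 ∂ν < ∞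

theorem HasSqIntegrableDensity.refl (μ : Measure α) [IsFiniteMeasure μ] :
    HasSqIntegrableDensity μ μ :=
  ⟨1, measurable_one, withDensity_one.symm, by simp [measure_lt_top]⟩

theorem HasSqIntegrableDensity.prod {μ ν : Measure α} {μ' ν' : Measure β} [SFinite ν] [SFinite ν']
    (h : HasSqIntegrableDensity μ ν) (h' : HasSqIntegrableDensity μ' ν') :
    HasSqIntegrableDensity (μ.prod μ') (ν.prod ν') := by
  obtain ⟨f, hf, rfl, hf2⟩ := h
  obtain ⟨g, hg, rfl, hg2⟩ := h'
  refine ⟨fun z => f z.1 * g z.2, by fun_prop, prod_withDensity hf hg, ?_⟩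
  simp_rw [mul_pow]
  rw [lintegral_prod_mul (f := fun x => f x ^ 2) (g := fun y => g y ^ 2) (by fun_prop)
    (by fun_prop)]
  exact ENNReal.mul_lt_top hf2 hg2

/-- A square integrable function is integrable under a law with square integrable density. -/
theorem HasSqIntegrableDensity.integrable {μ ν : Measure α} (h : HasSqIntegrableDensity μ ν)
    {T : α → ℝ} (hT : Measurable T) (hT2 : MemLp T 2 ν) : Integrable T μ := by
  obtain ⟨f, hf, rfl, hf2⟩ := h
  refine ⟨hT.aestronglyMeasurable, ?_⟩
  rw [HasFiniteIntegral, lintegral_withDensity_eq_lintegral_mul _ hf hT.enorm]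
  have hsq : ∫⁻ x, ‖T x‖ₑ ^ 2 ∂ν < ∞ := by
    have := (memLp_two_iff_integrable_sq hT.aestronglyMeasurable).1 hT2 |>.2
    simpa [HasFiniteIntegral, enorm_pow] using this
  -- The crude bound `f |T| ≤ f² + |T|²` replaces Cauchy–Schwarz, as only finiteness matters.
  refine lt_of_le_of_lt (b := ∫⁻ x, (f x ^ 2 + ‖T x‖ₑ ^ 2) ∂ν) (lintegral_mono fun x => ?_) ?_
  · simp only [Pi.mul_apply]
    rcases le_total (f x) ‖T x‖ₑ with h | h
    · calc f x * ‖T x‖ₑ ≤ ‖T x‖ₑ * ‖T x‖ₑ := by gcongr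
        _ = ‖T x‖ₑ ^ 2 := (sq _).symm
        _ ≤ _ := le_add_self
    · calc f x * ‖T x‖ₑ ≤ f x * f x := by gcongr
        _ = f x ^ 2 := (sq _).symm
        _ ≤ _ := le_self_add
  · rw [lintegral_add_left (by fun_prop)]
    exact ENNReal.add_lt_top.2 ⟨hf2, hsq⟩

variable {ι : Type*} [Fintype ι]

theorem lintegral_pi_prod (μ : Measure α) [IsProbabilityMeasure μ] {f : ι → α → ℝ≥0∞}
    (hf : ∀ i, Measurable (f i)) :
    ∫⁻ x, ∏ i, f i (x i) ∂(Measure.pi fun _ : ι => μ) = ∏ i, ∫⁻ x, f i x ∂μ := by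
  rw [lintegral_prod_eq_prod_lintegral_of_indepFun Finset.univ (fun i (x : ι → α) => f i (x i))
    (iIndepFun_pi fun i => (hf i).aemeasurable) fun i => (hf i).comp (measurable_pi_apply i)]
  refine Finset.prod_congr rfl fun i _ => ?_
  exact (measurePreserving_eval (fun _ : ι => μ) i).lintegral_comp (hf i)

/-- It suffices to test on boxes, where indicator times density factors over the coordinates. -/
theorem pi_withDensity (μ : Measure α) [IsProbabilityMeasure μ] {f : α → ℝ≥0∞}
    (hf : Measurable f) [SigmaFinite (μ.withDensity f)] :
    (Measure.pi fun _ : ι => μ.withDensity f) =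
      (Measure.pi fun _ : ι => μ).withDensity fun x => ∏ i, f (x i) := by
  refine Measure.pi_eq fun s hs => ?_
  have hpi : MeasurableSet (Set.univ.pi s) := MeasurableSet.univ_pi hs
  rw [withDensity_apply _ hpi, ← lintegral_indicator hpi]
  simp_rw [withDensity_apply _ (hs _), ← lintegral_indicator (hs _)]
  rw [← lintegral_pi_prod μ fun i => hf.indicator (hs i)]
  refine lintegral_congr fun x => ?_
  by_cases hx : x ∈ Set.univ.pi s
  · rw [Set.indicator_of_mem hx]
    exact Finset.prod_congr rfl fun i _ => (Set.indicator_of_mem (hx i trivial) f).symm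
  · rw [Set.indicator_of_notMem hx]
    simp only [Set.mem_pi, Set.mem_univ, forall_const, not_forall] at hx
    obtain ⟨i, hi⟩ := hx
    exact (Finset.prod_eq_zero (Finset.mem_univ i) (Set.indicator_of_notMem hi f)).symm

variable (ι) in
theorem HasSqIntegrableDensity.pi {μ ν : Measure α} [IsProbabilityMeasure ν] [SigmaFinite μ]
    (h : HasSqIntegrableDensity μ ν) :
    HasSqIntegrableDensity (Measure.pi fun _ : ι => μ) (Measure.pi fun _ : ι => ν) := by
  obtain ⟨f, hf, rfl, hf2⟩ := h
  refine ⟨fun x => ∏ i, f (x i), by fun_prop, pi_withDensity ν hf, ?_⟩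
  simp_rw [← Finset.prod_pow]
  rw [lintegral_pi_prod (ι := ι) ν (f := fun _ x => f x ^ 2) fun _ => by fun_prop]
  exact ENNReal.prod_lt_top fun _ _ => hf2

/-- Unbiased estimators with unbounded expected values along a family of laws dominated by a
multiple of one law `ν₀` are not square integrable under any law with respect to which `ν₀` has a
square integrable density. -/
theorem evariance_eq_top_of_unbounded_mean {μ ν₀ : Measure α} [IsFiniteMeasure μ]
    (h : HasSqIntegrableDensity ν₀ μ) {T : α → ℝ} (hT : Measurable T) (K : ℝ≥0)
    (hB : ∀ B : ℝ, ∃ P : Measure α, P ≤ K • ν₀ ∧ B < |∫ x, T x ∂P|) :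
    evariance T μ = ∞ := by
  refine evariance_eq_top hT.aestronglyMeasurable fun hT2 => ?_
  have hint : Integrable T (K • ν₀) := (h.integrable hT hT2).smul_measure_nnreal
  obtain ⟨P, hP, hlt⟩ := hB (∫ x, ‖T x‖ ∂(K • ν₀))
  refine absurd hlt (not_lt.2 ?_)
  exact (norm_integral_le_integral_norm T).trans
    (integral_mono_measure hP (Filter.Eventually.of_forall fun x => norm_nonneg _) hint.norm)

end Density

/-! ### Gamma laws of common shape -/

section Gamma

theorem gammaMeasure_eq_withDensity {a r r' : ℝ} (ha : 0 < a) (hr : 0 < r) (hr' : 0 < r') :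
    gammaMeasure a r' = (gammaMeasure a r).withDensity fun x =>
      ENNReal.ofReal ((r' / r) ^ a * Real.exp (-((r' - r) * x))) := by
  have hm : Measurable (gammaPDF a r) := (measurable_gammaPDFReal a r).ennreal_ofReal
  unfold gammaMeasure
  rw [← withDensity_mul _ hm (by fun_prop)]
  congr 1
  ext x
  rw [Pi.mul_apply, gammaPDF, gammaPDF, ← ENNReal.ofReal_mul (gammaPDFReal_nonneg ha hr x)]
  congr 1
  unfold gammaPDFReal
  split_ifs with hx
  · have h1 : Real.exp (-(r' * x)) = Real.exp (-(r * x)) * Real.exp (-((r' - r) * x)) := by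
      rw [← Real.exp_add]; ring_nf
    have h2 : r ^ a ≠ 0 := by positivity
    rw [h1, Real.div_rpow hr'.le hr.le]
    field_simp
  · simp

/-- The squared likelihood ratio is a constant times the likelihood ratio for rate `2 * r' - r`.
When this rate is positive, the latter integrates to one. -/
theorem hasSqIntegrableDensity_gammaMeasure {a r r' : ℝ} (ha : 0 < a) (hr : 0 < r) (hr' : 0 < r')
    (h : r < 2 * r') : HasSqIntegrableDensity (gammaMeasure a r') (gammaMeasure a r) := by
  refine ⟨_, by fun_prop, gammaMeasure_eq_withDensity ha hr hr', ?_⟩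
  have hs : 0 < 2 * r' - r := by linarith
  have hc : ∀ x, ENNReal.ofReal ((r' / r) ^ a * Real.exp (-((r' - r) * x))) ^ 2 =
      ENNReal.ofReal (((r' / r) ^ a) ^ 2 / ((2 * r' - r) / r) ^ a) *
        ENNReal.ofReal (((2 * r' - r) / r) ^ a * Real.exp (-((2 * r' - r - r) * x))) := by
    intro x
    rw [← ENNReal.ofReal_pow (by positivity), ← ENNReal.ofReal_mul (by positivity)]
    congr 1
    have h1 : Real.exp (-((2 * r' - r - r) * x)) = Real.exp (-((r' - r) * x)) ^ 2 := by
      rw [← Real.exp_nat_mul]; congr 1; push_cast; ring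
    have h2 : ((2 * r' - r) / r) ^ a ≠ 0 := by positivity
    rw [h1, mul_pow, ← mul_assoc, div_mul_cancel₀ _ h2]
  simp_rw [hc]
  rw [lintegral_const_mul _ (by fun_prop)]
  refine ENNReal.mul_lt_top ENNReal.ofReal_lt_top ?_
  have := congrArg (fun μ => μ Set.univ) (gammaMeasure_eq_withDensity ha hr hs)
  simp only [withDensity_apply _ MeasurableSet.univ, Measure.restrict_univ] at this
  rw [← this]
  have := isProbabilityMeasure_gammaMeasure ha hs
  simp

/-- Raising the rate shrinks the exponential factor, so only the normalising ratio `(r' / r) ^ a ≤ 2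
^ a` has to be paid. -/
theorem gammaMeasure_le {a r r' : ℝ} (ha : 0 < a) (hr : 0 < r) (h : r ≤ r') (h2 : r' ≤ 2 * r) :
    gammaMeasure a r' ≤ ((2 : ℝ) ^ a).toNNReal • gammaMeasure a r := by
  have hr' : 0 < r' := hr.trans_le h
  have hm : Measurable (gammaPDF a r) := (measurable_gammaPDFReal a r).ennreal_ofReal
  have hK : ((2 : ℝ) ^ a).toNNReal • gammaMeasure a r =
      volume.withDensity (ENNReal.ofReal ((2 : ℝ) ^ a) • gammaPDF a r) := by
    rw [withDensity_smul _ hm]; rfl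
  rw [hK]
  refine withDensity_mono (Filter.Eventually.of_forall fun x => ?_)
  rw [Pi.smul_apply, smul_eq_mul, gammaPDF, gammaPDF, ← ENNReal.ofReal_mul (by positivity)]
  refine ENNReal.ofReal_le_ofReal ?_
  unfold gammaPDFReal
  split_ifs with hx
  · have hp : r' ^ a ≤ 2 ^ a * r ^ a := by
      rw [← Real.mul_rpow (by norm_num) hr.le]
      exact Real.rpow_le_rpow hr'.le h2 ha.le
    calc r' ^ a / Real.Gamma a * x ^ (a - 1) * Real.exp (-(r' * x))
        ≤ (2 ^ a * r ^ a) / Real.Gamma a * x ^ (a - 1) * Real.exp (-(r * x)) := by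
          have := Real.Gamma_pos_of_pos ha
          gcongr
      _ = _ := by ring
  · simp

end Gamma

/-! ### Normal laws -/

section Gaussian

theorem gaussianReal_eq_withDensity (m₁ m₂ : ℝ) {v₁ v₂ : ℝ≥0} (h₁ : v₁ ≠ 0) (h₂ : v₂ ≠ 0) :
    gaussianReal m₁ v₁ = (gaussianReal m₂ v₂).withDensity fun x =>
      ENNReal.ofReal (gaussianPDFReal m₁ v₁ x / gaussianPDFReal m₂ v₂ x) := by
  rw [gaussianReal_of_var_ne_zero _ h₁, gaussianReal_of_var_ne_zero _ h₂,
    ← withDensity_mul _ (by fun_prop) (by fun_prop)]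
  congr 1
  ext x
  have hp := gaussianPDFReal_pos m₂ v₂ x h₂
  rw [Pi.mul_apply, gaussianPDF, gaussianPDF, ← ENNReal.ofReal_mul hp.le]
  congr 1
  field_simp

theorem hasSqIntegrableDensity_gaussianReal (m₁ m₂ : ℝ) {v₁ v₂ : ℝ≥0} (h₁ : v₁ ≠ 0) (h₂ : v₂ ≠ 0)
    (h : v₁ < 2 * v₂) :
    HasSqIntegrableDensity (gaussianReal m₁ v₁) (gaussianReal m₂ v₂) := by
  refine ⟨_, by fun_prop, gaussianReal_eq_withDensity m₁ m₂ h₁ h₂, ?_⟩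
  have hv₁ : (0 : ℝ) < v₁ := by positivity
  have hv₂ : (0 : ℝ) < v₂ := by positivity
  have hv : (v₁ : ℝ) < 2 * v₂ := by exact_mod_cast h
  -- Completing the square in the exponent of `p₁² / p₂`: the leading coefficient is `-w / (2 v₁
  -- v₂)`, the centre is `M`, and `c` below is the remaining constant.
  set w : ℝ := 2 * v₂ - v₁ with hw
  have hwpos : 0 < w := by linarith
  set M : ℝ := (2 * v₂ * m₁ - v₁ * m₂) / w with hM
  have hint : Integrable fun x : ℝ => Real.exp (-(w / (2 * v₁ * v₂)) * (x - M) ^ 2) :=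
    (integrable_exp_neg_mul_sq (by positivity)).comp_sub_right M
  set A : ℝ := (√(2 * Real.pi * v₁))⁻¹ with hA
  set B : ℝ := (√(2 * Real.pi * v₂))⁻¹ with hB
  have hApos : 0 < A := by positivity
  have hBpos : 0 < B := by positivity
  set c : ℝ := w / (2 * v₁ * v₂) * M ^ 2 - m₁ ^ 2 / v₁ + m₂ ^ 2 / (2 * v₂) with hc
  have hint' := hint.const_mul (A ^ 2 / B * Real.exp c)
  rw [gaussianReal_of_var_ne_zero _ h₂, lintegral_withDensity_eq_lintegral_mul _ (by fun_prop)
    (by fun_prop)]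
  refine (lintegral_congr fun x => ?_).trans_lt hint'.lintegral_lt_top
  have hp := gaussianPDFReal_pos m₂ v₂ x h₂
  have hp' := gaussianPDFReal_pos m₁ v₁ x h₁
  rw [Pi.mul_apply, gaussianPDF, ← ENNReal.ofReal_pow (by positivity),
    ← ENNReal.ofReal_mul hp.le]
  congr 1
  rw [show gaussianPDFReal m₂ v₂ x * (gaussianPDFReal m₁ v₁ x / gaussianPDFReal m₂ v₂ x) ^ 2 =
    gaussianPDFReal m₁ v₁ x ^ 2 / gaussianPDFReal m₂ v₂ x by field_simp]
  rw [gaussianPDFReal, gaussianPDFReal, ← hA, ← hB, mul_pow, mul_div_mul_comm, mul_assoc,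
    ← Real.exp_add, ← Real.exp_nat_mul, ← Real.exp_sub]
  congr 2
  rw [hc, hM]
  push_cast
  field_simp
  rw [hw]
  ring

/-- The smaller variance has the smaller exponential; the prefactors differ by at most `√2`, rounded
up to 2. -/
theorem gaussianPDFReal_le_two_mul (m x : ℝ) {v v' : ℝ≥0} (hv' : v' ≠ 0) (h : v' ≤ v)
    (h2 : v ≤ 2 * v') : gaussianPDFReal m v' x ≤ 2 * gaussianPDFReal m v x := by
  have hv'p : (0 : ℝ) < v' := by positivity
  have hle : (v' : ℝ) ≤ v := by exact_mod_cast h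
  have hle2 : (v : ℝ) ≤ 2 * v' := by exact_mod_cast h2
  have hvp : (0 : ℝ) < v := hv'p.trans_le hle
  have hs : (√(2 * Real.pi * v'))⁻¹ ≤ 2 * (√(2 * Real.pi * v))⁻¹ := by
    rw [← div_eq_mul_inv, inv_eq_one_div, div_le_div_iff₀ (by positivity) (by positivity), one_mul]
    rw [Real.sqrt_le_left (by positivity), mul_pow, Real.sq_sqrt (by positivity)]
    nlinarith [Real.pi_pos, mul_le_mul_of_nonneg_left hle2 Real.pi_pos.le, mul_pos Real.pi_pos hv'p]
  have he : Real.exp (-(x - m) ^ 2 / (2 * v')) ≤ Real.exp (-(x - m) ^ 2 / (2 * v)) := by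
    rw [Real.exp_le_exp, neg_div, neg_div, neg_le_neg_iff]
    gcongr
  rw [gaussianPDFReal, gaussianPDFReal, ← mul_assoc]
  exact mul_le_mul hs he (Real.exp_pos _).le (by positivity)

theorem pi_gaussianReal_le (n : ℕ) (m : ℝ) {v v' : ℝ≥0} (hv' : v' ≠ 0) (h : v' ≤ v)
    (h2 : v ≤ 2 * v') :
    (Measure.pi fun _ : Fin n => gaussianReal m v') ≤
      (2 ^ n : ℝ≥0) • Measure.pi fun _ : Fin n => gaussianReal m v := by
  have hv : v ≠ 0 := (lt_of_lt_of_le (pos_iff_ne_zero.2 hv') h).ne'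
  have heq := gaussianReal_eq_withDensity m m hv' hv
  have : SigmaFinite ((gaussianReal m v).withDensity fun x =>
      ENNReal.ofReal (gaussianPDFReal m v' x / gaussianPDFReal m v x)) := by
    rw [← heq]; infer_instance
  have hK : ((2 ^ n : ℝ≥0) • Measure.pi fun _ : Fin n => gaussianReal m v) =
      (Measure.pi fun _ : Fin n => gaussianReal m v).withDensity fun _ => 2 ^ n := by
    rw [withDensity_const]
    ext s _
    simp [Measure.smul_apply, ENNReal.smul_def]
  rw [heq, pi_withDensity _ (by fun_prop), hK]
  refine withDensity_mono (Filter.Eventually.of_forall fun x => ?_)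
  calc ∏ i, ENNReal.ofReal (gaussianPDFReal m v' (x i) / gaussianPDFReal m v (x i))
      ≤ ∏ _i : Fin n, (2 : ℝ≥0∞) := by
        refine Finset.prod_le_prod' fun i _ => ?_
        rw [← ENNReal.ofReal_ofNat 2]
        refine ENNReal.ofReal_le_ofReal ?_
        rw [div_le_iff₀ (gaussianPDFReal_pos m v _ hv)]
        exact gaussianPDFReal_le_two_mul m _ hv' h h2
    _ = 2 ^ n := by simp

end Gaussian

/-! ### Domination of products and the pair of gamma variables -/

theorem prod_smul_le_right {α β : Type*} [MeasurableSpace α] [MeasurableSpace β]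
    {μ : Measure α} {ν ν' : Measure β} [SFinite ν'] [SFinite ν] {K : ℝ≥0} (h : ν ≤ K • ν') :
    μ.prod ν ≤ K • μ.prod ν' := by
  have := Measure.prod_mono (le_refl μ) h
  rwa [Measure.prod_smul_right] at this

theorem prod_smul_le_left {α β : Type*} [MeasurableSpace α] [MeasurableSpace β]
    {μ μ' : Measure α} {ν : Measure β} [SFinite ν] {K : ℝ≥0} (h : μ ≤ K • μ') :
    μ.prod ν ≤ K • μ'.prod ν := by
  have := Measure.prod_mono h (le_refl ν)
  rwa [Measure.prod_smul_left] at this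

/-- Below every positive `a` there are points at which `1 / (a - ·)` exceeds a given bound. -/
theorem exists_lt_one_div_sub {a : ℝ} (ha : 0 < a) (B : ℝ) :
    ∃ b, a / 2 ≤ b ∧ b < a ∧ B < 1 / (a - b) := by
  -- The cap `a / 2` keeps the ratio to `a` within 2, so that the domination constant does not
  -- depend on `B`.
  refine ⟨a - min (a / 2) (1 / (|B| + 1)), ?_, ?_, ?_⟩
  · linarith [min_le_left (a / 2) (1 / (|B| + 1))]
  · have : 0 < min (a / 2) (1 / (|B| + 1)) := lt_min (by positivity) (by positivity)
    linarith
  · have h0 : 0 < min (a / 2) (1 / (|B| + 1)) := lt_min (by positivity) (by positivity)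
    rw [sub_sub_cancel]
    calc B < |B| + 1 := by linarith [le_abs_self B]
      _ = 1 / (1 / (|B| + 1)) := by rw [one_div_one_div]
      _ ≤ _ := one_div_le_one_div_of_le h0 (min_le_right _ _)

theorem gammaRate_bounds {α κ κ' : ℝ} (hα : 0 < α) (hκ : 0 < κ) (h : κ / 2 ≤ κ') (h' : κ' ≤ κ) :
    α / κ ≤ α / κ' ∧ α / κ' ≤ 2 * (α / κ) := by
  have hκ' : 0 < κ' := by linarith
  constructor
  · gcongr
  · rw [← mul_div_assoc, div_le_div_iff₀ hκ' hκ]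
    nlinarith

theorem evariance_gammaPairLaw_eq_top_right {α₁ α₂ : ℝ} (hα₁ : 0 < α₁) (hα₂ : 0 < α₂)
    {T : ℝ × ℝ → ℝ} (hT : Measurable T) {κ₁ : ℝ} (hκ₁ : 0 < κ₁)
    (hU : ∀ κ₂ : ℝ, 0 < κ₂ → κ₂ < κ₁ → UnbiasedForTauAt α₁ α₂ T κ₁ κ₂)
    {κ₂ : ℝ} (hκ₂ : 0 < κ₂) (h : 1 / 2 < κ₂ / κ₁) :
    evariance T (gammaPairLaw α₁ α₂ κ₁ κ₂) = ∞ := by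
  have h' : κ₁ < 2 * κ₂ := by
    rw [lt_div_iff₀ hκ₁] at h; linarith
  have hP₁ := isProbabilityMeasure_gammaMeasure hα₁ (div_pos hα₁ hκ₁)
  have hP₂ := isProbabilityMeasure_gammaMeasure hα₂ (div_pos hα₂ hκ₂)
  have hP₀ := isProbabilityMeasure_gammaMeasure hα₂ (div_pos hα₂ hκ₁)
  unfold gammaPairLaw
  -- `ν₀` is the law on the diagonal, both means being `κ₁`; only the second factor moves.
  refine evariance_eq_top_of_unbounded_mean
    ((HasSqIntegrableDensity.refl (gammaMeasure α₁ (α₁ / κ₁))).prod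
      (hasSqIntegrableDensity_gammaMeasure hα₂ (div_pos hα₂ hκ₂) (div_pos hα₂ hκ₁) ?_)) hT
    ((2 : ℝ) ^ α₂).toNNReal fun B => ?_
  · rw [← mul_div_assoc, div_lt_div_iff₀ hκ₂ hκ₁]
    nlinarith
  · obtain ⟨κ, h1, h2, h3⟩ := exists_lt_one_div_sub hκ₁ B
    have hκ : 0 < κ := by linarith
    have hP := isProbabilityMeasure_gammaMeasure hα₂ (div_pos hα₂ hκ)
    obtain ⟨hb, hb'⟩ := gammaRate_bounds hα₂ hκ₁ h1 h2.le
    refine ⟨gammaPairLaw α₁ α₂ κ₁ κ,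
      prod_smul_le_right (gammaMeasure_le hα₂ (div_pos hα₂ hκ₁) hb hb'), ?_⟩
    rw [(hU κ hκ h2).2]
    exact h3.trans_le (le_abs_self _)

theorem evariance_gammaPairLaw_eq_top_left {α₁ α₂ : ℝ} (hα₁ : 0 < α₁) (hα₂ : 0 < α₂)
    {T : ℝ × ℝ → ℝ} (hT : Measurable T) {κ₂ : ℝ} (hκ₂ : 0 < κ₂)
    (hU : ∀ κ₁ : ℝ, 0 < κ₁ → κ₁ < κ₂ → UnbiasedForTauAt α₁ α₂ T κ₁ κ₂)
    {κ₁ : ℝ} (hκ₁ : 0 < κ₁) (h : κ₂ / κ₁ < 2) :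
    evariance T (gammaPairLaw α₁ α₂ κ₁ κ₂) = ∞ := by
  have h' : κ₂ < 2 * κ₁ := (div_lt_iff₀ hκ₁).1 h
  have hP₁ := isProbabilityMeasure_gammaMeasure hα₁ (div_pos hα₁ hκ₁)
  have hP₂ := isProbabilityMeasure_gammaMeasure hα₂ (div_pos hα₂ hκ₂)
  have hP₀ := isProbabilityMeasure_gammaMeasure hα₁ (div_pos hα₁ hκ₂)
  unfold gammaPairLaw
  refine evariance_eq_top_of_unbounded_mean
    ((hasSqIntegrableDensity_gammaMeasure hα₁ (div_pos hα₁ hκ₁) (div_pos hα₁ hκ₂) ?_).prod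
      (HasSqIntegrableDensity.refl (gammaMeasure α₂ (α₂ / κ₂)))) hT
    ((2 : ℝ) ^ α₁).toNNReal fun B => ?_
  · rw [← mul_div_assoc, div_lt_div_iff₀ hκ₁ hκ₂]
    nlinarith
  · obtain ⟨κ, h1, h2, h3⟩ := exists_lt_one_div_sub hκ₂ B
    have hκ : 0 < κ := by linarith
    obtain ⟨hb, hb'⟩ := gammaRate_bounds hα₁ hκ₂ h1 h2.le
    refine ⟨gammaPairLaw α₁ α₂ κ κ₂,
      prod_smul_le_left (gammaMeasure_le hα₁ (div_pos hα₁ hκ₂) hb hb'), ?_⟩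
    -- Here the means tend to `-∞`, hence the absolute value.
    rw [(hU κ hκ h2).2, abs_one_div, abs_sub_comm, ← abs_one_div]
    exact h3.trans_le (le_abs_self _)

/-! ### The conversion gain -/

namespace PixelParams

theorem lightVar_pos (θ : PixelParams) : 0 < θ.lightVar :=
  add_pos_of_pos_of_nonneg θ.darkVar_pos (div_nonneg θ.electrons_nonneg (sq_nonneg _))

/-- The parameters with dark noise of mean `m` and variance `d`, at which the illumination raises
the mean by one and the variance to `v`. -/
noncomputable def ofVars {m d v : ℝ} (hm : 0 < m) (hd : 0 < d) (hdv : d < v) : PixelParams where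
  g := 1 / (v - d)
  electrons := 1 / (v - d)
  darkMean := m
  darkVar := d
  g_pos := one_div_pos.2 (sub_pos.2 hdv)
  electrons_nonneg := (one_div_pos.2 (sub_pos.2 hdv)).le
  darkMean_pos := hm
  darkVar_pos := hd

theorem lightMean_ofVars {m d v : ℝ} (hm : 0 < m) (hd : 0 < d) (hdv : d < v) :
    (ofVars hm hd hdv).lightMean = m + 1 := by
  have : v - d ≠ 0 := (sub_pos.2 hdv).ne'
  simp only [lightMean, ofVars]
  field_simp

theorem lightVar_ofVars {m d v : ℝ} (hm : 0 < m) (hd : 0 < d) (hdv : d < v) :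
    (ofVars hm hd hdv).lightVar = v := by
  have : v - d ≠ 0 := (sub_pos.2 hdv).ne'
  simp only [lightVar, ofVars]
  field_simp
  ring

theorem evariance_eq_top (θ : PixelParams) {n₁ n₂ : ℕ} {G : (Fin n₁ → ℝ) × (Fin n₂ → ℝ) → ℝ}
    (hG : Measurable G)
    (hU : ∀ θ' : PixelParams, θ'.lightVar = θ.lightVar → 0 < θ'.electrons → θ'.UnbiasedForGainAt G)
    (hζ : 1 / 2 < θ.zeta) : evariance G (θ.dataLaw n₁ n₂) = ∞ := by
  have hv := θ.lightVar_pos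
  have hd := θ.darkVar_pos
  have hlt : θ.lightVar < 2 * θ.darkVar := by
    rw [zeta, lt_div_iff₀ hv] at hζ; linarith
  set v := θ.lightVar with hvdef
  have hv0 : v.toNNReal ≠ 0 := (Real.toNNReal_pos.2 hv).ne'
  have hd0 : θ.darkVar.toNNReal ≠ 0 := (Real.toNNReal_pos.2 hd).ne'
  unfold dataLaw
  -- `ν₀` has variance `v` in both samples and means `darkMean + 1` and `darkMean`. It lies outside
  -- the model but is the limit of the laws `ofVars` as `d` increases to `v`, where the gain `1 / (v
  -- - d)` diverges.
  refine evariance_eq_top_of_unbounded_mean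
    (((hasSqIntegrableDensity_gaussianReal (θ.darkMean + 1) θ.lightMean hv0 hv0 ?_).pi
      (Fin n₁)).prod
    ((hasSqIntegrableDensity_gaussianReal θ.darkMean θ.darkMean hv0 hd0 ?_).pi (Fin n₂))) hG
    (2 ^ n₂) fun B => ?_
  · rw [← NNReal.coe_lt_coe]
    push_cast
    rw [Real.coe_toNNReal _ hv.le]
    linarith
  · rw [← NNReal.coe_lt_coe]
    push_cast
    rw [Real.coe_toNNReal _ hv.le, Real.coe_toNNReal _ hd.le]
    exact hlt
  · obtain ⟨d, h1, h2, h3⟩ := exists_lt_one_div_sub hv B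
    have hdp : 0 < d := by linarith
    refine ⟨(ofVars θ.darkMean_pos hdp h2).dataLaw n₁ n₂, ?_, ?_⟩
    · unfold dataLaw
      rw [lightMean_ofVars, lightVar_ofVars]
      refine prod_smul_le_right (pi_gaussianReal_le n₂ θ.darkMean
        (Real.toNNReal_pos.2 hdp).ne' (Real.toNNReal_le_toNNReal h2.le) ?_)
      rw [← NNReal.coe_le_coe]
      push_cast
      rw [Real.coe_toNNReal _ hv.le]
      change v ≤ 2 * (d.toNNReal : ℝ)
      rw [Real.coe_toNNReal _ hdp.le]
      linarith
    · rw [(hU (ofVars θ.darkMean_pos hdp h2) (lightVar_ofVars _ _ _)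
        (one_div_pos.2 (sub_pos.2 h2))).2]
      exact h3.trans_le (le_abs_self _)

end PixelParams

theorem mainTheorem3
    (α₁ α₂ : ℝ) (hα₁ : 0 < α₁) (hα₂ : 0 < α₂)
    (T : ℝ × ℝ → ℝ) (hT : Measurable T)
    (n₁ n₂ : ℕ) (hn₁ : 2 ≤ n₁) (hn₂ : 2 ≤ n₂)
    (G : (Fin n₁ → ℝ) × (Fin n₂ → ℝ) → ℝ) (hG : Measurable G) :
    -- `κ₁` and `κ₂` both unknown
    ((∀ κ₁ κ₂ : ℝ, 0 < κ₁ → 0 < κ₂ → κ₁ ≠ κ₂ → UnbiasedForTauAt α₁ α₂ T κ₁ κ₂) →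
      ∀ κ₁ κ₂ : ℝ, 0 < κ₁ → 0 < κ₂ → 1 / 2 < κ₂ / κ₁ → κ₂ / κ₁ < 2 →
        evariance T (gammaPairLaw α₁ α₂ κ₁ κ₂) = ⊤) ∧
    -- unbiasedness only for one value of `κ₁` and all `κ₂ < κ₁`
    (∀ κ₁ : ℝ, 0 < κ₁ →
      (∀ κ₂ : ℝ, 0 < κ₂ → κ₂ < κ₁ → UnbiasedForTauAt α₁ α₂ T κ₁ κ₂) →
      ∀ κ₂ : ℝ, 0 < κ₂ → 1 / 2 < κ₂ / κ₁ → κ₂ / κ₁ ≤ 1 →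
        evariance T (gammaPairLaw α₁ α₂ κ₁ κ₂) = ⊤) ∧
    -- unbiasedness only for one value of `κ₂` and all `κ₁ < κ₂`
    (∀ κ₂ : ℝ, 0 < κ₂ →
      (∀ κ₁ : ℝ, 0 < κ₁ → κ₁ < κ₂ → UnbiasedForTauAt α₁ α₂ T κ₁ κ₂) →
      ∀ κ₁ : ℝ, 0 < κ₁ → 1 ≤ κ₂ / κ₁ → κ₂ / κ₁ < 2 →
        evariance T (gammaPairLaw α₁ α₂ κ₁ κ₂) = ⊤) ∧
    -- the conversion gain, all parameters unknown
    ((∀ θ : PixelParams, 0 < θ.electrons → θ.UnbiasedForGainAt G) →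
      ∀ θ : PixelParams, 1 / 2 < θ.zeta → θ.zeta ≤ 1 →
        evariance G (θ.dataLaw n₁ n₂) = ⊤) ∧
    -- the conversion gain, unbiasedness only for one value of the illuminated variance
    (∀ v : ℝ, 0 < v →
      (∀ θ : PixelParams, θ.lightVar = v → 0 < θ.electrons → θ.UnbiasedForGainAt G) →
      ∀ θ : PixelParams, θ.lightVar = v → 1 / 2 < θ.zeta → θ.zeta ≤ 1 →
        evariance G (θ.dataLaw n₁ n₂) = ⊤) := by
  -- The claims with all parameters unknown follow by freezing `κ₁`, or the illuminated variance, at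
  -- its value at the point considered.
  refine ⟨fun hU κ₁ κ₂ h₁ h₂ hl hu => ?_, fun κ₁ h₁ hU κ₂ h₂ hl _ => ?_,
    fun κ₂ h₂ hU κ₁ h₁ _ hu => ?_, fun hU θ hζ _ => ?_, fun v _ hU θ hθ hζ _ => ?_⟩
  · exact evariance_gammaPairLaw_eq_top_right hα₁ hα₂ hT h₁
      (fun κ hκ hlt => hU κ₁ κ h₁ hκ hlt.ne') h₂ hl
  · exact evariance_gammaPairLaw_eq_top_right hα₁ hα₂ hT h₁ hU h₂ hl
  · exact evariance_gammaPairLaw_eq_top_left hα₁ hα₂ hT h₂ hU h₁ hu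
  · exact θ.evariance_eq_top hG (fun θ' _ => hU θ') hζ
  · exact θ.evariance_eq_top hG (fun θ' h => hU θ' (h.trans hθ)) hζ
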